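/- Let $d \ge 2$ and $k \ge \max\{2,(d-1)(d-2)\}$ be integers. Call a nonempty set $S \subseteq \mathbb{R}^d$ star-shaped if there is a point $p$ such that for every $q \in S$ the closed segment $[p,q]$ is contained in $S$. For a set $A \subseteq \mathbb{R}^d$ and an integer $m \ge 1$, let $A[m] = \{a_1 + \cdots + a_m : a_1, \ldots, a_m \in A\}$ be the Minkowski sum of $m$ copies of $A$, and let $\operatorname{vol}$ denote Lebesgue measure on $\mathbb{R}^d$. If $A \subset \mathbb{R}^d$ is a compact set such that $\partial S \subseteq A \subseteq S$ for some compact, star-shaped set $S \subset \mathbb{R}^d$, where $\partial S$ is the topological boundary of $S$, then $$\operatorname{vol}\left(\frac{1}{k} A[k]\right) \le \operatorname{vol}\left(\frac{1}{k+1} A[k+1]\right).$$ -/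

import Mathlib

open MeasureTheory
open scoped Pointwise

/-- The `k`-fold Minkowski sum `A[k] = {a₁ + ⋯ + aₖ : a₁, …, aₖ ∈ A}`. -/
def minkowskiSum {E : Type*} [AddCommMonoid E] (A : Set E) (k : ℕ) : Set E :=
  {x | ∃ a : Fin k → E, (∀ i, a i ∈ A) ∧ ∑ i, a i = x}

/-- A set is star-shaped if it is nonempty and there is a point `p` such that the segment `[p, q]`
is contained in the set for every point `q` of the set. -/
def IsStarShaped {E : Type*} [AddCommGroup E] [Module ℝ E] (S : Set E) : Prop :=
  S.Nonempty ∧ ∃ p : E, ∀ q ∈ S, segment ℝ p q ⊆ S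

/-!
After a translation `S` is star-shaped about the origin. Write `S[k]` for the Minkowski sum.

*Reduction to `A = S`.* In dimension at least two, the frontier of a compact star-shaped set is
connected (`StarConvex.isPreconnected_frontier`). Comparing `S` with its reflection in the midpoint
of two of its points, one gets `S + S ⊆ ∂S + ∂S`
(`StarConvex.add_subset_frontier_add_frontier`), hence `A[k] = S[k]` for `k ≥ 2`.

*Comparison of deficits.* Let `K` be the convex hull of `S`. As `(1/k) S[k] ⊆ K`, it is enough to
compare the deficits, that is, to show `vol ((k+1)K \ S[k+1]) ≤ ((k+1)/k)^d vol (kK \ S[k])`.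
The set `K` is approximated by the convex hull `Q` of the origin and a finite subset `F` of `S`.
A radial perturbation, which does not leave `S`, puts `F` in general position
(`exists_generalPosition`). Then the simplicial cones over the facets of `Q` that miss the origin
cover the cone over `F` and overlap in a null set only; this is linear programming duality for the
problem of minimizing the sum of the coefficients of a nonnegative combination of points of `F`.

Let `z` be a point of `(k+1)Q \ S[k+1]` in the cone over a facet with vertices `p i`, and let
`z = ∑ t i • p i`. If `t i ≥ 1`, then `z - p i` lies in `kQ`, by the equation of the facet, and not
in `S[k]`, as `p i ∈ S`; so it belongs to the deficit for `k`. On the other hand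
`∑ (⌊t i⌋ + 1) ≤ k + 1` would imply `z ∈ S[k+1]`, because `t i • p i` is a sum of `⌊t i⌋ + 1` points
of `S`; hence `∑ ⌊t i⌋ ≥ k + 2 - d`. Spreading the mass at `z` over the points `z - p i` with
weights proportional to `⌊t i⌋` gives the factor `(k + 1) / (k + 2 - d)` between the two deficits
(`measure_le_of_sub_basis_mem`). For `k ≥ (d - 1) (d - 2)` it is at most `((k + 1) / k) ^ d`
(`pow_le_sub_mul_pow`).
-/

open Filter Topology Set
open scoped ENNReal

/-! ### Minkowski sums -/

section MinkowskiSum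

variable {E : Type*} [AddCommGroup E]

theorem minkowskiSum_zero (A : Set E) : minkowskiSum A 0 = {0} := by
  ext x
  simp [minkowskiSum, eq_comm]

theorem minkowskiSum_succ (A : Set E) (k : ℕ) :
    minkowskiSum A (k + 1) = minkowskiSum A k + A := by
  ext x
  constructor
  · rintro ⟨a, ha, rfl⟩
    rw [Fin.sum_univ_castSucc]
    exact add_mem_add ⟨fun i => a i.castSucc, fun i => ha _, rfl⟩ (ha _)
  · rintro ⟨_, ⟨a, ha, rfl⟩, y, hy, rfl⟩
    refine ⟨Fin.snoc (α := fun _ => E) a y, fun i => ?_, ?_⟩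
    · refine Fin.lastCases ?_ (fun j => ?_) i
      · simpa using hy
      · simpa using ha j
    · simp [Fin.sum_univ_castSucc]

theorem minkowskiSum_one (A : Set E) : minkowskiSum A 1 = A := by
  rw [minkowskiSum_succ A 0, minkowskiSum_zero, singleton_zero, zero_add]

theorem minkowskiSum_add (A : Set E) (m n : ℕ) :
    minkowskiSum A (m + n) = minkowskiSum A m + minkowskiSum A n := by
  induction n with
  | zero => rw [minkowskiSum_zero, singleton_zero, add_zero, add_zero]
  | succ n ih => rw [← add_assoc, minkowskiSum_succ, ih, minkowskiSum_succ, add_assoc]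

theorem minkowskiSum_mono {A B : Set E} (h : A ⊆ B) (k : ℕ) :
    minkowskiSum A k ⊆ minkowskiSum B k := by
  rintro _ ⟨a, ha, rfl⟩
  exact ⟨a, fun i => h (ha i), rfl⟩

theorem minkowskiSum_subset_of_le {A : Set E} (h0 : (0 : E) ∈ A) {m n : ℕ} (h : m ≤ n) :
    minkowskiSum A m ⊆ minkowskiSum A n := by
  obtain ⟨j, rfl⟩ := Nat.exists_eq_add_of_le h
  rw [minkowskiSum_add]
  exact subset_add_left _ ⟨fun _ => 0, fun _ => h0, by simp⟩

theorem nsmul_mem_minkowskiSum {A : Set E} {x : E} (hx : x ∈ A) (n : ℕ) :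
    n • x ∈ minkowskiSum A n :=
  ⟨fun _ => x, fun _ => hx, by simp⟩

theorem sum_mem_minkowskiSum {A : Set E} {ι : Type*} (s : Finset ι) (x : ι → E) (n : ι → ℕ)
    (h : ∀ i ∈ s, x i ∈ minkowskiSum A (n i)) :
    ∑ i ∈ s, x i ∈ minkowskiSum A (∑ i ∈ s, n i) := by
  classical
  induction s using Finset.induction_on with
  | empty => simp [minkowskiSum_zero]
  | insert a s ha ih =>
    rw [Finset.sum_insert ha, Finset.sum_insert ha, minkowskiSum_add]
    exact add_mem_add (h a (by simp)) (ih fun i hi => h i (by simp [hi]))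

theorem minkowskiSum_vadd (v : E) (A : Set E) (k : ℕ) :
    minkowskiSum (v +ᵥ A) k = (k • v) +ᵥ minkowskiSum A k := by
  induction k with
  | zero => simp [minkowskiSum_zero]
  | succ k ih =>
    rw [minkowskiSum_succ, ih, minkowskiSum_succ]
    simp only [← singleton_vadd, vadd_eq_add, add_smul, one_smul]
    rw [← singleton_add_singleton]
    abel

/-- If every sum of two points of `S` is a sum of two points of `B ⊆ S`, then the same holds for
sums of any number `k ≥ 2` of points. -/
theorem minkowskiSum_subset_of_add_subset {B S : Set E} (hBS : B ⊆ S) (h : S + S ⊆ B + B)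
    {k : ℕ} (hk : 2 ≤ k) : minkowskiSum S k ⊆ minkowskiSum B k := by
  induction k, hk using Nat.le_induction with
  | base => simpa only [minkowskiSum_succ _ 1, minkowskiSum_one] using h
  | succ k hk ih =>
    obtain ⟨j, rfl⟩ := Nat.exists_eq_add_of_le' (show 1 ≤ k by omega)
    rw [minkowskiSum_succ S]
    refine (add_subset_add_right ih).trans ?_
    rw [minkowskiSum_succ B j, add_assoc, minkowskiSum_succ B, minkowskiSum_succ B, add_assoc]
    exact add_subset_add_left ((add_subset_add_right hBS).trans h)

theorem IsCompact.minkowskiSum [TopologicalSpace E] [ContinuousAdd E] {A : Set E}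
    (hA : IsCompact A) (k : ℕ) : IsCompact (minkowskiSum A k) := by
  induction k with
  | zero => rw [minkowskiSum_zero]; exact isCompact_singleton
  | succ k ih => rw [minkowskiSum_succ]; exact ih.add hA

end MinkowskiSum

/-! ### The frontier of a star-shaped set -/

section Boundary

variable {E : Type*} [NormedAddCommGroup E] [NormedSpace ℝ E]

/-- Existence of the radial function of a compact set that is star-shaped about the origin. -/
theorem exists_radial {S : Set E} (hS : IsCompact S) (hstar : StarConvex ℝ 0 S)
    (h0 : (0 : E) ∈ S) {u : E} (hu : u ≠ 0) :
    ∃ r : ℝ, 0 ≤ r ∧ ∀ t : ℝ, 0 ≤ t → (t • u ∈ S ↔ t ≤ r) := by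
  have hcont : Continuous fun t : ℝ => t • u := by fun_prop
  obtain ⟨M, hM⟩ := hS.isBounded.exists_norm_le
  have hc : IsCompact {t : ℝ | 0 ≤ t ∧ t • u ∈ S} := by
    refine (isCompact_Icc (a := (0 : ℝ)) (b := M / ‖u‖)).of_isClosed_subset
      (isClosed_Ici.inter (hS.isClosed.preimage hcont)) ?_
    rintro t ⟨ht, htS⟩
    refine ⟨ht, ?_⟩
    rw [le_div_iff₀ (norm_pos_iff.2 hu)]
    simpa [norm_smul, abs_of_nonneg ht] using hM _ htS
  obtain ⟨r, ⟨hr0, hrS⟩, hr⟩ := hc.exists_isGreatest ⟨0, le_rfl, by simpa using h0⟩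
  refine ⟨r, hr0, fun t ht => ⟨fun h => hr ⟨ht, h⟩, fun h => ?_⟩⟩
  rcases hr0.eq_or_lt with h' | h'
  · obtain rfl : t = 0 := by linarith
    simpa using h0
  · have := starConvex_zero_iff.1 hstar hrS (div_nonneg ht hr0)
      (div_le_one_of_le₀ h hr0)
    rwa [smul_smul, div_mul_cancel₀ _ h'.ne'] at this

/-- The frontier of a compact star-shaped set in dimension at least two is connected: it fibres
over the unit sphere, and the fibre over a direction `u` is a segment ending at the last point of
the set in that direction. -/
theorem StarConvex.isPreconnected_frontier {S : Set E} (hS : IsCompact S)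
    (hstar : StarConvex ℝ 0 S) (h0 : (0 : E) ∈ S) (hE : 1 < Module.rank ℝ E)
    [FiniteDimensional ℝ E] : IsPreconnected (frontier S) := by
  have hne : ∀ u ∈ Metric.sphere (0 : E) 1, u ≠ 0 := fun u hu h => by simp [h] at hu
  choose! r hr0 hr using fun u (hu : u ∈ Metric.sphere (0 : E) 1) =>
    exists_radial hS hstar h0 (hne u hu)
  -- If points `s n • u n` at or beyond the ends of their rays tend to `a • v`, then the part of the
  -- ray of `v` from `a • v` to its end lies in the frontier.
  have key : ∀ (u : ℕ → E) (s : ℕ → ℝ) (v : E) (a : ℝ), (∀ n, u n ∈ Metric.sphere (0 : E) 1) →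
      v ∈ Metric.sphere (0 : E) 1 → Tendsto u atTop (𝓝 v) → Tendsto s atTop (𝓝 a) →
      (∀ n, r (u n) ≤ s n) → ∀ τ, 0 ≤ τ → a ≤ τ → τ ≤ r v → τ • v ∈ frontier S := by
    intro u s v a hu hv huv hsa hrs τ hτ haτ hτr
    rw [frontier_eq_closure_inter_closure]
    refine ⟨subset_closure ((hr v hv τ hτ).2 hτr), ?_⟩
    have h1 : Tendsto (fun n : ℕ => max τ (s n) + 1 / ((n : ℝ) + 1)) atTop (𝓝 τ) := by
      have := (tendsto_const_nhds (x := τ)).max hsa |>.add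
        tendsto_one_div_add_atTop_nhds_zero_nat
      simpa [max_eq_left haτ] using this
    refine mem_closure_of_tendsto (h1.smul huv) (Eventually.of_forall fun n hn => ?_)
    have hpos : 0 < 1 / ((n : ℝ) + 1) := by positivity
    have := (hr (u n) (hu n) _ (by positivity)).1 hn
    linarith [hrs n, le_max_right τ (s n)]
  have hend : ∀ v ∈ Metric.sphere (0 : E) 1, r v • v ∈ frontier S := fun v hv =>
    key (fun _ => v) (fun _ => r v) v (r v) (fun _ => hv) hv tendsto_const_nhds
      tendsto_const_nhds (fun _ => le_rfl) _ (hr0 v hv) le_rfl le_rfl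
  rw [isPreconnected_closed_iff]
  intro t t' ht ht' hcov hmt hmt'
  by_contra hcon
  have hseg : ∀ t t' : Set E, IsClosed t → IsClosed t' → frontier S ⊆ t ∪ t' →
      ¬ (frontier S ∩ (t ∩ t')).Nonempty →
      ∀ (u : ℕ → E) (s : ℕ → ℝ) (v : E) (a : ℝ), (∀ n, u n ∈ Metric.sphere (0 : E) 1) →
      v ∈ Metric.sphere (0 : E) 1 → Tendsto u atTop (𝓝 v) → Tendsto s atTop (𝓝 a) →
      (∀ n, r (u n) ≤ s n) → 0 ≤ a → a • v ∈ S → a • v ∈ t → r v • v ∈ t := by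
    intro t t' ht ht' hcov hcon u s v a hu hv huv hsa hrs ha haS hat
    have har := (hr v hv a ha).1 haS
    have himg : (fun τ : ℝ => τ • v) '' Icc a (r v) ⊆ frontier S := by
      rintro _ ⟨τ, ⟨h1, h2⟩, rfl⟩
      exact key u s v a hu hv huv hsa hrs τ (ha.trans h1) h1 h2
    have hpre : IsPreconnected ((fun τ : ℝ => τ • v) '' Icc a (r v)) :=
      isPreconnected_Icc.image _ (by fun_prop)
    rcases hcov (hend v hv) with h | h
    · exact h
    · refine (hcon ?_).elim
      obtain ⟨x, hx, hx'⟩ := isPreconnected_closed_iff.1 hpre t t' ht ht' (himg.trans hcov)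
        ⟨_, ⟨a, ⟨le_rfl, har⟩, rfl⟩, hat⟩ ⟨_, ⟨r v, ⟨har, le_rfl⟩, rfl⟩, h⟩
      exact ⟨x, himg hx, hx'⟩
  -- The directions whose endpoint lies in a given closed part of the frontier form a closed set.
  have hclosed : ∀ t t' : Set E, IsClosed t → IsClosed t' → frontier S ⊆ t ∪ t' →
      ¬ (frontier S ∩ (t ∩ t')).Nonempty →
      IsClosed {v | v ∈ Metric.sphere (0 : E) 1 ∧ r v • v ∈ t} := by
    intro t t' ht ht' hcov hcon
    rw [← isSeqClosed_iff_isClosed]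
    intro u v hu huv
    have hv : v ∈ Metric.sphere (0 : E) 1 :=
      Metric.isClosed_sphere.mem_of_tendsto huv (Eventually.of_forall fun n => (hu n).1)
    obtain ⟨q, hq, φ, hφ, hlim⟩ := hS.tendsto_subseq (x := fun n => r (u n) • u n)
      fun n => (hr _ (hu n).1 _ (hr0 _ (hu n).1)).2 le_rfl
    have hnorm : Tendsto (fun n => r (u (φ n))) atTop (𝓝 ‖q‖) := by
      refine hlim.norm.congr fun n => ?_
      have h1 : ‖u (φ n)‖ = 1 := by simpa using (hu (φ n)).1
      simp [norm_smul, h1, abs_of_nonneg (hr0 _ (hu (φ n)).1)]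
    have hqv : q = ‖q‖ • v :=
      tendsto_nhds_unique hlim (hnorm.smul (huv.comp hφ.tendsto_atTop))
    refine ⟨hv, hseg t t' ht ht' hcov hcon (u ∘ φ) (fun n => r (u (φ n))) v ‖q‖
      (fun n => (hu _).1) hv (huv.comp hφ.tendsto_atTop) hnorm (fun n => le_rfl)
      (norm_nonneg _) (hqv ▸ hq) ?_⟩
    rw [← hqv]
    exact ht.mem_of_tendsto hlim (Eventually.of_forall fun n => (hu _).2)
  have hmeet : ∀ t t' : Set E, IsClosed t → IsClosed t' → frontier S ⊆ t ∪ t' →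
      ¬ (frontier S ∩ (t ∩ t')).Nonempty → (frontier S ∩ t).Nonempty →
      ∃ v, v ∈ Metric.sphere (0 : E) 1 ∧ r v • v ∈ t := by
    rintro t t' ht ht' hcov hcon ⟨q, hqS, hqt⟩
    have hq1 := hS.isClosed.frontier_subset hqS
    rw [frontier_eq_closure_inter_closure] at hqS
    obtain ⟨x, hx, hxq⟩ := mem_closure_iff_seq_limit.1 hqS.2
    have hx0 : ∀ n, x n ≠ 0 := fun n h => hx n (h ▸ h0)
    have hu : ∀ n, ‖x n‖⁻¹ • x n ∈ Metric.sphere (0 : E) 1 := fun n => by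
      simp [norm_smul, inv_mul_cancel₀ (norm_ne_zero_iff.2 (hx0 n))]
    obtain ⟨v, hv, φ, hφ, hlim⟩ := (isCompact_sphere (0 : E) 1).tendsto_subseq hu
    have hnorm : Tendsto (fun n => ‖x (φ n)‖) atTop (𝓝 ‖q‖) :=
      (hxq.comp hφ.tendsto_atTop).norm
    have hqv : q = ‖q‖ • v := by
      refine tendsto_nhds_unique (hxq.comp hφ.tendsto_atTop) ((hnorm.smul hlim).congr fun n => ?_)
      simp [smul_smul, mul_inv_cancel₀ (norm_ne_zero_iff.2 (hx0 (φ n)))]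
    refine ⟨v, hv, hseg t t' ht ht' hcov hcon _ _ v ‖q‖ (fun n => hu (φ n)) hv hlim hnorm
      (fun n => ?_) (norm_nonneg _) (hqv ▸ hq1) (hqv ▸ hqt)⟩
    by_contra! h
    refine hx (φ n) ?_
    have := (hr _ (hu (φ n)) _ (norm_nonneg (x (φ n)))).2 h.le
    rwa [smul_smul, mul_inv_cancel₀ (norm_ne_zero_iff.2 (hx0 (φ n))), one_smul] at this
  have hcov' : frontier S ⊆ t' ∪ t := by rwa [union_comm]
  have hcon' : ¬ (frontier S ∩ (t' ∩ t)).Nonempty := by rwa [inter_comm t' t]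
  obtain ⟨v, hv⟩ := hmeet t t' ht ht' hcov hcon hmt
  obtain ⟨w, hw⟩ := hmeet t' t ht' ht hcov' hcon' hmt'
  obtain ⟨z, hz, hz1, hz2⟩ := isPreconnected_closed_iff.1 (isPreconnected_sphere hE (0 : E) 1)
    _ _ (hclosed t t' ht ht' hcov hcon) (hclosed t' t ht' ht hcov' hcon')
    (fun z hz => (hcov (hend z hz)).imp (fun h => ⟨hz, h⟩) fun h => ⟨hz, h⟩)
    ⟨v, hv.1, hv⟩ ⟨w, hw.1, hw⟩
  exact hcon ⟨_, hend z hz, hz1.2, hz2.2⟩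

/-- Every sum of two points of a compact star-shaped set in dimension at least two is a sum of two
of its frontier points. Otherwise the frontier of `S` misses that of its reflection `T` in the
midpoint `c` of the two points, and by connectedness either `frontier S ⊆ interior T` or
`T ⊆ interior S`.
Both are impossible: `S` and `T` have the same largest distance from `c`, and it is not attained
at an interior point. -/
theorem StarConvex.add_subset_frontier_add_frontier [FiniteDimensional ℝ E] {S : Set E}
    (hS : IsCompact S) (hstar : StarConvex ℝ 0 S) (h0 : (0 : E) ∈ S)
    (hE : 1 < Module.rank ℝ E) : S + S ⊆ frontier S + frontier S := by
  have : Nontrivial E := rank_pos_iff_nontrivial.1 (zero_lt_one.trans hE)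
  rintro _ ⟨x, hx, y, hy, rfl⟩
  by_contra hcon
  set m := x + y with hm
  set T : Set E := (Homeomorph.subLeft m) ⁻¹' S with hT
  have hTmem : ∀ q, q ∈ T ↔ m - q ∈ S := fun q => Iff.rfl
  have hTc : IsClosed T := hS.isClosed.preimage (Homeomorph.subLeft m).continuous
  have hTi : interior T = (Homeomorph.subLeft m) ⁻¹' interior S :=
    ((Homeomorph.subLeft m).preimage_interior S).symm
  have hTf : frontier T = (Homeomorph.subLeft m) ⁻¹' frontier S :=
    ((Homeomorph.subLeft m).preimage_frontier S).symm
  have hdisj : ∀ q ∈ frontier S, q ∉ frontier T := by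
    intro q hq hq'
    rw [hTf] at hq'
    exact hcon ⟨q, hq, m - q, hq', add_sub_cancel q m⟩
  obtain ⟨q, hq, hmax⟩ := hS.exists_isMaxOn ⟨0, h0⟩
    (f := fun q => dist q ((1 / 2 : ℝ) • m)) (by fun_prop)
  have hint : ∀ z ∈ interior S, dist z ((1 / 2 : ℝ) • m) < dist q ((1 / 2 : ℝ) • m) := by
    intro z hz
    have : S ⊆ Metric.closedBall ((1 / 2 : ℝ) • m) (dist q ((1 / 2 : ℝ) • m)) :=
      fun w hw => hmax hw
    simpa [interior_closedBall'] using interior_mono this hz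
  have hrefl : m - q ∉ interior S := by
    intro h
    refine (hint _ h).ne ?_
    rw [dist_eq_norm, dist_eq_norm, ← norm_neg]
    congr 1
    have : m = (1 / 2 : ℝ) • m + (1 / 2 : ℝ) • m := by rw [← add_smul]; norm_num
    nth_rewrite 1 [this]
    abel
  have hSf : ∀ z ∈ S, z ∉ interior S → z ∈ frontier S := fun z hz hz' => by
    rw [hS.isClosed.frontier_eq]; exact ⟨hz, hz'⟩
  have hqf : q ∈ frontier S := hSf q hq fun h => (hint q h).false
  have hTcase : ∀ z ∈ T, z ∉ frontier T → z ∈ interior T := fun z hz hz' => by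
    rw [hTc.frontier_eq] at hz'
    by_contra h
    exact hz' ⟨hz, h⟩
  by_cases hq' : q ∈ T
  · have hqT := hTcase q hq' (hdisj q hqf)
    rw [hTi] at hqT
    exact hrefl hqT
  · have hsub : frontier S ⊆ Tᶜ := by
      refine (hstar.isPreconnected_frontier hS h0 hE).subset_left_of_subset_union
        hTc.isOpen_compl isOpen_interior
        (disjoint_left.2 fun z hz hz' => hz (interior_subset hz')) (fun z hz => ?_) ⟨q, hqf, hq'⟩
      by_cases hzT : z ∈ T
      · exact Or.inr (hTcase z hzT (hdisj z hz))
      · exact Or.inl hzT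
    have hTpre : IsPreconnected T := by
      rw [hT, ← Homeomorph.image_symm]
      exact (hstar.isPathConnected h0).isConnected.isPreconnected.image _
        (Homeomorph.continuous _).continuousOn
    have hxT : x ∈ T := by rw [hTmem, hm]; simpa using hy
    have hTS : T ⊆ interior S := by
      refine hTpre.subset_left_of_subset_union isOpen_interior hS.isClosed.isOpen_compl
        (disjoint_left.2 fun z hz hz' => hz' (interior_subset hz)) (fun z hz => ?_) ⟨x, hxT, ?_⟩
      · by_contra h
        simp only [mem_union, mem_compl_iff, not_or, not_not] at h
        exact hsub (hSf z h.2 h.1) hz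
      · by_contra h
        exact hsub (hSf x hx h) hxT
    exact hrefl (hTS ((hTmem _).2 (by simpa using hq)))

end Boundary

/-! ### Transport along a basis -/

section Transport

variable {E : Type*} [NormedAddCommGroup E] [NormedSpace ℝ E] [MeasurableSpace E] [BorelSpace E]
  [FiniteDimensional ℝ E]

theorem measurable_coord {ι : Type*} (b : Module.Basis ι ℝ E) (i : ι) :
    Measurable fun z => b.repr z i :=
  (LinearMap.continuous_of_finiteDimensional (b.coord i)).measurable

/-- A transport inequality in the coordinates of a basis `b`. Each point `z` of `D'` is split among
the translates `z - b i`, with weights proportional to the integer parts of its coordinates; the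
weights received by a point of `D` whose integer parts sum to `M ≥ N - 1` add up to
`(M + d) / (M + 1) ≤ (N + d - 1) / N`, where `d` is the dimension. -/
theorem measure_le_of_sub_basis_mem (μ : Measure E) [μ.IsAddHaarMeasure] {ι : Type*} [Fintype ι]
    (b : Module.Basis ι ℝ E) {D D' : Set E} (hD : MeasurableSet D) (hD' : MeasurableSet D')
    {N : ℕ} (hN : 1 ≤ N) (hsub : ∀ z ∈ D', ∀ i, 1 ≤ b.repr z i → z - b i ∈ D)
    (hfloor : ∀ z ∈ D', N ≤ ∑ i, ⌊b.repr z i⌋₊) :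
    (N : ℝ≥0∞) * μ D' ≤ ((N + Fintype.card ι - 1 : ℕ) : ℝ≥0∞) * μ D := by
  classical
  let n : E → ι → ℕ := fun z i => ⌊b.repr z i⌋₊
  let w : ι → E → ℝ≥0∞ := fun i =>
    D'.indicator fun z => (n z i : ℝ≥0∞) * ((∑ j, n z j : ℕ) : ℝ≥0∞)⁻¹
  have hn : ∀ i, Measurable fun z => n z i := fun i =>
    Nat.measurable_floor.comp (measurable_coord b i)
  have hw : ∀ i, Measurable (w i) := fun i => by
    refine Measurable.indicator ?_ hD'
    have h1 : Measurable fun z => ∑ j, n z j := Finset.measurable_sum _ fun j _ => hn j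
    exact ((measurable_from_top (f := fun k : ℕ => (k : ℝ≥0∞))).comp (hn i)).mul
      ((measurable_from_top (f := fun k : ℕ => (k : ℝ≥0∞)⁻¹)).comp h1)
  have hsum : ∀ z, ∑ i, w i z = D'.indicator 1 z := by
    intro z
    by_cases hz : z ∈ D'
    · simp only [w, indicator_of_mem hz, ← Finset.sum_mul, Pi.one_apply]
      rw [← Nat.cast_sum]
      refine ENNReal.mul_inv_cancel ?_ (ENNReal.natCast_ne_top _)
      have := hfloor z hz
      exact_mod_cast (show (∑ j, n z j) ≠ 0 by simp only [n]; omega)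
    · simp [w, hz]
  have hbound : ∀ y, (N : ℝ≥0∞) * ∑ i, w i (y + b i) ≤
      D.indicator (fun _ => ((N + Fintype.card ι - 1 : ℕ) : ℝ≥0∞)) y := by
    intro y
    -- A summand is nonzero only if `y` lies in `D` and all coordinates of `y` are nonnegative.
    have hcase : ∀ i, w i (y + b i) ≠ 0 → y ∈ D ∧ N ≤ (∑ j, n y j) + 1 ∧
        w i (y + b i) = ((n y i + 1 : ℕ) : ℝ≥0∞) * (((∑ j, n y j) + 1 : ℕ) : ℝ≥0∞)⁻¹ := by
      intro i hi
      have hmem : y + b i ∈ D' := by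
        by_contra h
        simp [w, h] at hi
      simp only [w, indicator_of_mem hmem] at hi ⊢
      have h1 : n (y + b i) i ≠ 0 := by
        intro h
        simp [h] at hi
      have h2 : 1 ≤ b.repr (y + b i) i := by
        by_contra! h
        exact h1 (Nat.floor_eq_zero.2 h)
      have h3 : 0 ≤ b.repr y i := by simpa using h2
      have hni : n (y + b i) i = n y i + 1 := by
        simp only [n, map_add, Finsupp.add_apply, Module.Basis.repr_self, Finsupp.single_eq_same]
        exact Nat.floor_add_one h3
      have hnj : ∀ j, j ≠ i → n (y + b i) j = n y j := by
        intro j hj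
        simp [n, hj.symm]
      have hs : ∑ j, n (y + b i) j = (∑ j, n y j) + 1 := by
        rw [← Finset.add_sum_erase _ _ (Finset.mem_univ i), hni,
          ← Finset.add_sum_erase _ (n y) (Finset.mem_univ i),
          Finset.sum_congr rfl fun j hj => hnj j (Finset.ne_of_mem_erase hj)]
        ring
      refine ⟨by simpa using hsub _ hmem i h2, ?_, by rw [hni, hs]⟩
      rw [← hs]
      exact hfloor _ hmem
    by_cases hex : ∃ i, w i (y + b i) ≠ 0
    · obtain ⟨i₀, hi₀⟩ := hex
      obtain ⟨hyD, hNy, -⟩ := hcase i₀ hi₀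
      rw [indicator_of_mem hyD]
      have hle : ∑ i, w i (y + b i) ≤
          ∑ i, ((n y i + 1 : ℕ) : ℝ≥0∞) * (((∑ j, n y j) + 1 : ℕ) : ℝ≥0∞)⁻¹ := by
        refine Finset.sum_le_sum fun i _ => ?_
        by_cases hi : w i (y + b i) = 0
        · rw [hi]; exact zero_le
        · exact (hcase i hi).2.2.le
      have hcount : ∑ i, (n y i + 1) = (∑ j, n y j) + Fintype.card ι := by
        simp [Finset.sum_add_distrib]
      rw [← Finset.sum_mul, ← Nat.cast_sum, hcount] at hle
      have hι : 1 ≤ Fintype.card ι := Fintype.card_pos_iff.2 ⟨i₀⟩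
      set M := ∑ j, n y j
      calc (N : ℝ≥0∞) * ∑ i, w i (y + b i)
          ≤ N * (((M + Fintype.card ι : ℕ) : ℝ≥0∞) * ((M + 1 : ℕ) : ℝ≥0∞)⁻¹) := by gcongr
        _ = ((N * (M + Fintype.card ι) : ℕ) : ℝ≥0∞) / ((M + 1 : ℕ) : ℝ≥0∞) := by
            rw [div_eq_mul_inv, ← mul_assoc]; push_cast; ring
        _ ≤ _ := by
            refine ENNReal.div_le_of_le_mul ?_
            rw [← Nat.cast_mul]
            refine Nat.cast_le.2 ?_
            -- This is `1 + (d - 1) / (M + 1) ≤ 1 + (d - 1) / N` with denominators cleared.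
            obtain ⟨c, hc⟩ := Nat.exists_eq_add_of_le' hι
            obtain ⟨e, he⟩ := Nat.exists_eq_add_of_le hNy
            rw [hc, show M + (c + 1) = N + e + c by omega,
              show N + (c + 1) - 1 = N + c by omega, he]
            nlinarith [Nat.zero_le (c * e)]
    · push Not at hex
      simp [hex]
  have hμ : μ D' = ∑ i, ∫⁻ y, w i (y + b i) ∂μ := by
    rw [← lintegral_indicator_one hD']
    simp_rw [← hsum]
    rw [lintegral_finsetSum _ fun i _ => hw i]
    exact Finset.sum_congr rfl fun i _ => (lintegral_add_right_eq_self (w i) (b i)).symm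
  have hw' : ∀ i, Measurable fun y => w i (y + b i) := fun i =>
    (hw i).comp (measurable_add_const (b i))
  rw [hμ, ← lintegral_finsetSum _ fun i _ => hw' i,
    ← lintegral_const_mul _ (Finset.measurable_fun_sum _ fun i _ => hw' i)]
  refine (lintegral_mono hbound).trans ?_
  rw [lintegral_indicator_const hD]

end Transport

/-! ### Triangulation of a polytope in general position -/

section Triangulation

variable {E : Type*} [AddCommGroup E] [Module ℝ E]

theorem mem_smul_convexHull_insert_zero_iff {F : Finset E} {m : ℝ} (hm : 0 < m) {z : E} :
    z ∈ m • convexHull ℝ (insert 0 (F : Set E)) ↔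
      ∃ t : E → ℝ, (∀ p ∈ F, 0 ≤ t p) ∧ ∑ p ∈ F, t p ≤ m ∧ ∑ p ∈ F, t p • p = z := by
  classical
  constructor
  · rintro ⟨x, hx, rfl⟩
    have hsub : convexHull ℝ (insert 0 (F : Set E)) ⊆
        {x | ∃ t : E → ℝ, (∀ p ∈ F, 0 ≤ t p) ∧ ∑ p ∈ F, t p ≤ 1 ∧ ∑ p ∈ F, t p • p = x} := by
      refine convexHull_min ?_ ?_
      · rintro p (rfl | hp)
        · exact ⟨0, by simp⟩
        · refine ⟨Pi.single p 1, fun q _ => ?_, ?_, ?_⟩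
          · by_cases h : q = p
            · subst h; simp
            · simp [h]
          · rw [Finset.sum_pi_single', if_pos (Finset.mem_coe.1 hp)]
          · simp [Pi.single_apply, ite_smul, Finset.mem_coe.1 hp]
      · rintro _ ⟨t, ht, ht1, rfl⟩ _ ⟨s, hs, hs1, rfl⟩ a b ha hb hab
        refine ⟨fun p => a * t p + b * s p, fun p hp => ?_, ?_, ?_⟩
        · have := ht p hp
          have := hs p hp
          positivity
        · rw [Finset.sum_add_distrib, ← Finset.mul_sum, ← Finset.mul_sum]
          nlinarith
        · simp only [add_smul, mul_smul, Finset.sum_add_distrib, Finset.smul_sum]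
    obtain ⟨t, ht, ht1, rfl⟩ := hsub hx
    refine ⟨fun p => m * t p, fun p hp => mul_nonneg hm.le (ht p hp), ?_, ?_⟩
    · rw [← Finset.mul_sum]
      nlinarith
    · simp only [mul_smul, Finset.smul_sum]
  · rintro ⟨t, ht, htm, rfl⟩
    have hconv := convex_convexHull ℝ (insert 0 (F : Set E))
    have h0 : (0 : E) ∈ convexHull ℝ (insert 0 (F : Set E)) :=
      subset_convexHull ℝ _ (mem_insert _ _)
    rcases (Finset.sum_nonneg ht).eq_or_lt with hs | hs
    · have hz := (Finset.sum_eq_zero_iff_of_nonneg ht).1 hs.symm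
      refine ⟨0, h0, ?_⟩
      rw [Finset.sum_eq_zero fun p hp => by rw [hz p hp, zero_smul]]
      simp
    · have hc := Finset.centerMass_mem_convexHull (s := insert 0 (F : Set E)) F ht hs
        (z := id) fun p hp => mem_insert_of_mem _ hp
      rw [mem_smul_set_iff_inv_smul_mem₀ hm.ne']
      have := hconv.smul_mem_of_zero_mem h0 hc
        (t := (∑ p ∈ F, t p) / m) ⟨by positivity, (div_le_one hm).2 htm⟩
      rw [Finset.centerMass, smul_smul, div_eq_inv_mul, mul_assoc, mul_inv_cancel₀ hs.ne',
        mul_one] at this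
      exact this

/-- A finite set is in general position relative to the origin if, for every affine hyperplane
missing the origin, its points on that hyperplane are linearly independent. -/
def GeneralPosition (F : Finset E) : Prop :=
  ∀ y : E →ₗ[ℝ] ℝ, LinearIndepOn ℝ id {p | p ∈ F ∧ y p = 1}

/-- A finite set can be put in general position by shrinking its points radially by factors as
close to `1` as desired: once the other points have been treated, each of the finitely many spans
of subsets of them excludes at most one factor for the next point. -/
theorem exists_generalPosition (F : Finset E) {ρ : ℝ} (hρ0 : 0 ≤ ρ) (hρ : ρ < 1) :
    ∃ G : Finset E, GeneralPosition G ∧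
      (∀ q ∈ G, ∃ p ∈ F, ∃ c ∈ Icc (0 : ℝ) 1, q = c • p) ∧
      ∀ p ∈ F, ∃ c ∈ Icc ρ 1, c • p ∈ G := by
  classical
  induction F using Finset.induction_on with
  | empty =>
    refine ⟨∅, fun y => ?_, by simp, by simp⟩
    simp
  | insert p F _ ih =>
    obtain ⟨G, hG, hGF, hFG⟩ := ih
    let bad : Finset E → Set ℝ := fun T =>
      {c | ∃ y : E →ₗ[ℝ] ℝ, (∀ q ∈ T, y q = 1) ∧ c • p ∈ Submodule.span ℝ (T : Set E) ∧
        y (c • p) = 1}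
    have hbad : ∀ T, (bad T).Subsingleton := by
      rintro T c ⟨y, hy, hc, hyc⟩ c' ⟨y', hy', hc', hyc'⟩
      have h1 : y (c • p) = y' (c • p) :=
        LinearMap.eqOn_span (fun q hq => by rw [hy q hq, hy' q hq]) hc
      rw [hyc, map_smul, smul_eq_mul] at h1
      rw [map_smul, smul_eq_mul] at hyc'
      have h2 : y' p ≠ 0 := by
        intro h
        simp [h] at h1
      exact mul_right_cancel₀ h2 (h1.symm.trans hyc'.symm)
    have hfin : (⋃ T ∈ G.powerset, bad T).Finite :=
      G.powerset.finite_toSet.biUnion fun T _ => (hbad T).finite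
    obtain ⟨c, hc, hcbad⟩ := (Icc_infinite hρ).exists_notMem_finite hfin
    have hcbad' : ∀ T ⊆ G, c ∉ bad T := fun T hT h =>
      hcbad (mem_biUnion (Finset.mem_coe.2 (Finset.mem_powerset.2 hT)) h)
    refine ⟨insert (c • p) G, fun y => ?_, ?_, ?_⟩
    · by_cases hy : y (c • p) = 1
      · have hset : {q | q ∈ insert (c • p) G ∧ y q = 1} =
            insert (c • p) {q | q ∈ G ∧ y q = 1} := by
          ext q
          simp only [Finset.mem_insert, mem_ofPred_eq, mem_insert_iff]
          constructor
          · rintro ⟨h | h, h'⟩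
            exacts [Or.inl h, Or.inr ⟨h, h'⟩]
          · rintro (rfl | ⟨h, h'⟩)
            exacts [⟨Or.inl rfl, hy⟩, ⟨Or.inr h, h'⟩]
        rw [hset]
        refine (hG y).insert fun hmem => ?_
        refine hcbad' (G.filter fun q => y q = 1) (Finset.filter_subset _ _)
          ⟨y, fun q hq => (Finset.mem_filter.1 hq).2, ?_, hy⟩
        simpa using hmem
      · refine (hG y).mono ?_
        rintro q ⟨hq, hq'⟩
        rcases Finset.mem_insert.1 hq with rfl | h
        · exact absurd hq' hy
        · exact ⟨h, hq'⟩
    · intro q hq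
      rcases Finset.mem_insert.1 hq with rfl | h
      · exact ⟨p, Finset.mem_insert_self _ _, c, ⟨hρ0.trans hc.1, hc.2⟩, rfl⟩
      · obtain ⟨r, hr, hr'⟩ := hGF q h
        exact ⟨r, Finset.mem_insert_of_mem hr, hr'⟩
    · intro q hq
      rcases Finset.mem_insert.1 hq with rfl | h
      · exact ⟨c, hc, Finset.mem_insert_self _ _⟩
      · obtain ⟨r, hr, hr'⟩ := hFG q h
        exact ⟨r, hr, Finset.mem_insert_of_mem hr'⟩

/-- The linear programming step of Carathéodory's theorem: a nonnegative combination can be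
rewritten over a linearly independent subset without increasing the sum of the coefficients. -/
theorem exists_linearIndepOn_sum_le (I : Finset E) (t : E → ℝ) (ht : ∀ p ∈ I, 0 ≤ t p) :
    ∃ J ⊆ I, ∃ s : E → ℝ, LinearIndepOn ℝ id (J : Set E) ∧ (∀ p ∈ J, 0 ≤ s p) ∧
      ∑ p ∈ J, s p • p = ∑ p ∈ I, t p • p ∧ ∑ p ∈ J, s p ≤ ∑ p ∈ I, t p := by
  classical
  induction I using Finset.strongInduction generalizing t with
  | H I ih =>
  by_cases hI : LinearIndepOn ℝ id (I : Set E)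
  · exact ⟨I, subset_rfl, t, hI, ht, rfl, le_rfl⟩
  obtain ⟨a, ha0, hasum, i, hi, hai⟩ : ∃ a : E → ℝ, ∑ p ∈ I, a p • p = 0 ∧
      0 ≤ ∑ p ∈ I, a p ∧ ∃ i ∈ I, 0 < a i := by
    rw [linearIndepOn_finset_iff] at hI
    push Not at hI
    obtain ⟨a, ha, i, hi, hai⟩ := hI
    obtain ⟨a, ha, hi', hasum⟩ : ∃ a : E → ℝ, ∑ p ∈ I, a p • p = 0 ∧ a i ≠ 0 ∧
        0 ≤ ∑ p ∈ I, a p := by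
      rcases le_total 0 (∑ p ∈ I, a p) with h | h
      · exact ⟨a, ha, hai, h⟩
      · refine ⟨-a, ?_, by simpa using hai, by simpa using h⟩
        simpa using ha
    refine ⟨a, ha, hasum, ?_⟩
    by_contra! hneg
    have h0 : ∑ p ∈ I, a p = 0 := le_antisymm (Finset.sum_nonpos hneg) hasum
    exact hi' ((Finset.sum_eq_zero_iff_of_nonpos hneg).1 h0 i hi)
  obtain ⟨q, hq, hmin⟩ := (I.filter fun p => 0 < a p).exists_min_image (fun p => t p / a p)
    ⟨i, Finset.mem_filter.2 ⟨hi, hai⟩⟩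
  obtain ⟨hqI, hqa⟩ := Finset.mem_filter.1 hq
  set c := t q / a q with hc
  have hc0 : 0 ≤ c := div_nonneg (ht q hqI) hqa.le
  have hq0 : t q - c * a q = 0 := by rw [hc, div_mul_cancel₀ _ hqa.ne', sub_self]
  obtain ⟨J, hJ, s, hs⟩ := ih (I.erase q) (Finset.erase_ssubset hqI) (fun p => t p - c * a p) (by
    intro p hp
    have hpI := Finset.mem_of_mem_erase hp
    rcases lt_or_ge 0 (a p) with h | h
    · have := hmin p (Finset.mem_filter.2 ⟨hpI, h⟩)
      rw [le_div_iff₀ h] at this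
      linarith
    · nlinarith [ht p hpI])
  refine ⟨J, hJ.trans (Finset.erase_subset _ _), s, hs.1, hs.2.1, hs.2.2.1.trans ?_,
    hs.2.2.2.trans ?_⟩
  · rw [Finset.sum_erase _ (by rw [hq0, zero_smul])]
    simp only [sub_smul, mul_smul, Finset.sum_sub_distrib, ← Finset.smul_sum, ha0, smul_zero,
      sub_zero]
  · rw [Finset.sum_erase (f := fun p => t p - c * a p) _ hq0, Finset.sum_sub_distrib,
      ← Finset.mul_sum]
    nlinarith

theorem LinearIndepOn.coeff_eq {J : Finset E} (hJ : LinearIndepOn ℝ id (J : Set E))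
    {s t : E → ℝ} (h : ∑ p ∈ J, s p • p = ∑ p ∈ J, t p • p) : ∀ p ∈ J, s p = t p := by
  intro p hp
  have := linearIndepOn_finset_iff.1 hJ (fun p => s p - t p)
    (by simp [sub_smul, Finset.sum_sub_distrib, h]) p hp
  linarith

/-- The sum of the coefficients of a nonnegative combination attains its minimum, and does so over
a linearly independent subset: each such subset allows at most one choice of coefficients. -/
theorem exists_minimal_linearIndepOn (F : Finset E) (t : E → ℝ) (ht : ∀ p ∈ F, 0 ≤ t p) :
    ∃ J ⊆ F, ∃ s : E → ℝ, LinearIndepOn ℝ id (J : Set E) ∧ (∀ p ∈ J, 0 ≤ s p) ∧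
      ∑ p ∈ J, s p • p = ∑ p ∈ F, t p • p ∧
      ∀ r : E → ℝ, (∀ p ∈ F, 0 ≤ r p) → ∑ p ∈ F, r p • p = ∑ p ∈ F, t p • p →
        ∑ p ∈ J, s p ≤ ∑ p ∈ F, r p := by
  let C : Finset E → Set ℝ := fun J => {c | ∃ s : E → ℝ, LinearIndepOn ℝ id (J : Set E) ∧
    (∀ p ∈ J, 0 ≤ s p) ∧ ∑ p ∈ J, s p • p = ∑ p ∈ F, t p • p ∧ c = ∑ p ∈ J, s p}
  have hC : ∀ J, (C J).Subsingleton := by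
    rintro J c ⟨s, hJ, -, hs, rfl⟩ c' ⟨s', -, -, hs', rfl⟩
    exact Finset.sum_congr rfl (hJ.coeff_eq (hs.trans hs'.symm))
  have hfin : (⋃ J ∈ F.powerset, C J).Finite :=
    F.powerset.finite_toSet.biUnion fun J _ => (hC J).finite
  have hne : (⋃ J ∈ F.powerset, C J).Nonempty := by
    obtain ⟨J, hJF, s, hJ, hs, hsum, -⟩ := exists_linearIndepOn_sum_le F t ht
    exact ⟨_, mem_biUnion (Finset.mem_coe.2 (Finset.mem_powerset.2 hJF)) ⟨s, hJ, hs, hsum, rfl⟩⟩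
  obtain ⟨c, hc, hmin⟩ := exists_min_image _ id hfin hne
  obtain ⟨J, hJF, s, hJ, hs, hsum, rfl⟩ := mem_iUnion₂.1 hc
  refine ⟨J, Finset.mem_powerset.1 hJF, s, hJ, hs, hsum, fun r hr hrsum => ?_⟩
  obtain ⟨J', hJF', s', hJ', hs', hsum', hle⟩ := exists_linearIndepOn_sum_le F r hr
  exact (hmin _ (mem_biUnion (Finset.mem_coe.2 (Finset.mem_powerset.2 hJF'))
    ⟨s', hJ', hs', hsum'.trans hrsum, rfl⟩)).trans hle

/-- The convex cone generated by a finite set. -/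
def finsetCone (I : Finset E) : Set E :=
  {z | ∃ t : E → ℝ, (∀ p ∈ I, 0 ≤ t p) ∧ ∑ p ∈ I, t p • p = z}

/-- The union of the spans of the subsets of `F` with fewer elements than the dimension of the
space. -/
def degenerateSet (F : Finset E) : Set E :=
  ⋃ J ∈ F.powerset.filter fun J => J.card < Module.finrank ℝ E,
    (Submodule.span ℝ (J : Set E) : Set E)

theorem finrank_le_card_of_sum_notMem_degenerateSet {F J : Finset E} (hJ : J ⊆ F) {t : E → ℝ}
    (hz : ∑ p ∈ J, t p • p ∉ degenerateSet F) : Module.finrank ℝ E ≤ J.card := by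
  by_contra! h
  refine hz (mem_biUnion (Finset.mem_coe.2 (Finset.mem_filter.2 ⟨Finset.mem_powerset.2 hJ, h⟩)) ?_)
  exact Submodule.sum_mem _ fun p hp => Submodule.smul_mem _ _ (Submodule.subset_span hp)

theorem coeff_pos_of_notMem_degenerateSet {F J : Finset E} (hJ : J ⊆ F)
    (hcard : J.card = Module.finrank ℝ E) {t : E → ℝ} (ht : ∀ p ∈ J, 0 ≤ t p)
    (hz : ∑ p ∈ J, t p • p ∉ degenerateSet F) : ∀ p ∈ J, 0 < t p := by
  classical
  intro p hp
  refine (ht p hp).lt_of_ne fun h => ?_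
  rw [← Finset.sum_erase J (a := p) (by rw [← h, zero_smul])] at hz
  have := finrank_le_card_of_sum_notMem_degenerateSet ((Finset.erase_subset p J).trans hJ) hz
  have := Finset.card_erase_lt_of_mem hp
  omega

/-- `I` spans a facet of the convex hull of `F ∪ {0}` that does not contain the origin, `y = 1`
being an equation of the supporting hyperplane; the points of `I` form a basis of the space. -/
structure IsFacetBasis (F I : Finset E) : Prop where
  subset : I ⊆ F
  linearIndepOn : LinearIndepOn ℝ id (I : Set E)
  card_eq : I.card = Module.finrank ℝ E
  exists_supporting : ∃ y : E →ₗ[ℝ] ℝ, (∀ p ∈ I, y p = 1) ∧ ∀ p ∈ F, y p ≤ 1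

theorem repr_sum_smul {I : Finset E} {b : Module.Basis I ℝ E} (hb : ∀ i : I, b i = (i : E))
    (t : E → ℝ) (i : I) : b.repr (∑ p ∈ I, t p • p) i = t i := by
  have : ∑ p ∈ I, t p • p = ∑ j : I, t j • b j := by
    simp only [hb]
    exact (Finset.sum_coe_sort I fun p => t p • p).symm
  rw [this, b.repr_sum_self fun j : I => t j]

theorem exists_sum_eq_of_basis {I : Finset E} (b : Module.Basis I ℝ E)
    (hb : ∀ i : I, b i = (i : E)) (z : E) : ∃ a : E → ℝ, ∑ p ∈ I, a p • p = z := by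
  classical
  refine ⟨fun p => if h : p ∈ I then b.repr z ⟨p, h⟩ else 0, ?_⟩
  rw [← Finset.sum_coe_sort I]
  conv_rhs => rw [← b.sum_repr z]
  exact Finset.sum_congr rfl fun i _ => by simp [hb]

variable [FiniteDimensional ℝ E]

theorem exists_basis_of_card_eq {I : Finset E} (hI : LinearIndepOn ℝ id (I : Set E))
    (hcard : I.card = Module.finrank ℝ E) :
    ∃ b : Module.Basis I ℝ E, ∀ i : I, b i = (i : E) := by
  have hli : LinearIndependent ℝ fun i : I => (i : E) := hI.linearIndependent
  have hspan := hli.span_eq_top_of_card_eq_finrank' (by simpa using hcard)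
  exact ⟨Module.Basis.mk hli hspan.ge, fun i => by simp⟩

/-- The cones over the facets cover the cone over `F`, up to degenerate points: a representation
of a point with minimal sum of coefficients is supported on a facet. -/
theorem exists_isFacetBasis_of_notMem_degenerateSet {F : Finset E} {z : E}
    (hz : z ∈ finsetCone F) (hzd : z ∉ degenerateSet F) :
    ∃ I, IsFacetBasis F I ∧ z ∈ finsetCone I := by
  classical
  obtain ⟨t, ht, rfl⟩ := hz
  obtain ⟨J, hJF, s, hJ, hs, hsum, hmin⟩ := exists_minimal_linearIndepOn F t ht
  rw [← hsum] at hzd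
  have hcard : J.card = Module.finrank ℝ E :=
    le_antisymm (by simpa using hJ.linearIndependent.fintype_card_le_finrank)
      (finrank_le_card_of_sum_notMem_degenerateSet hJF hzd)
  have hspos := coeff_pos_of_notMem_degenerateSet hJF hcard hs hzd
  obtain ⟨b, hb⟩ := exists_basis_of_card_eq hJ hcard
  let y : E →ₗ[ℝ] ℝ := b.constr ℝ fun _ => (1 : ℝ)
  have hy : ∀ p ∈ J, y p = 1 := fun p hp => by
    have := b.constr_basis ℝ (fun _ => (1 : ℝ)) ⟨p, hp⟩
    rwa [hb] at this
  refine ⟨J, ⟨hJF, hJ, hcard, y, hy, fun p hp => ?_⟩, s, hs, hsum⟩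
  by_contra! hlt
  obtain ⟨a, ha⟩ := exists_sum_eq_of_basis b hb p
  have hya : y p = ∑ q ∈ J, a q := by
    rw [← ha, map_sum]
    exact Finset.sum_congr rfl fun q hq => by rw [map_smul, hy q hq, smul_eq_mul, mul_one]
  -- Trading a small multiple of `p` against its expansion in `J` lowers the sum of coefficients.
  obtain ⟨ε, hε, hεpos⟩ : ∃ ε : ℝ, (∀ q ∈ J, ε * a q < s q) ∧ 0 < ε := by
    have h1 : ∀ᶠ ε : ℝ in 𝓝[>] 0, ∀ q ∈ J, ε * a q < s q := by
      refine (eventually_all_finset J).2 fun q hq => ?_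
      have : Tendsto (fun ε : ℝ => ε * a q) (𝓝[>] 0) (𝓝 (0 * a q)) :=
        ((continuous_mul_const (a q)).tendsto 0).mono_left nhdsWithin_le_nhds
      rw [zero_mul] at this
      exact this.eventually_lt_const (hspos q hq)
    exact (h1.and self_mem_nhdsWithin).exists
  have hJfilter : F.filter (· ∈ J) = J := by
    ext q
    simpa using fun h => hJF h
  have := hmin (fun q => (if q ∈ J then s q - ε * a q else 0) + if q = p then ε else 0)
    (fun q _ => by
      have h1 : 0 ≤ if q ∈ J then s q - ε * a q else 0 := by
        split_ifs with h
        · linarith [hε q h]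
        · exact le_rfl
      have h2 : 0 ≤ if q = p then ε else 0 := by split_ifs <;> linarith
      exact add_nonneg h1 h2)
    (by
      simp only [add_smul, ite_smul, zero_smul, Finset.sum_add_distrib, Finset.sum_ite_eq',
        if_pos hp, ← Finset.sum_filter, hJfilter]
      simp only [sub_smul, mul_smul, Finset.sum_sub_distrib, ← Finset.smul_sum, ha, hsum]
      abel)
  simp only [Finset.sum_add_distrib, Finset.sum_ite_eq', if_pos hp, ← Finset.sum_filter,
    hJfilter, Finset.sum_sub_distrib, ← Finset.mul_sum, ← hya] at this
  nlinarith

/-- In general position, the cones over two different facets meet in degenerate points only: at a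
common point both supporting functionals agree, so all vertices lie on a common hyperplane. -/
theorem IsFacetBasis.eq_of_mem_finsetCone {F I J : Finset E} (hF : GeneralPosition F)
    (hI : IsFacetBasis F I) (hJ : IsFacetBasis F J) {z : E} (hzI : z ∈ finsetCone I)
    (hzJ : z ∈ finsetCone J) (hzd : z ∉ degenerateSet F) : I = J := by
  classical
  obtain ⟨y, hy, hyF⟩ := hI.exists_supporting
  obtain ⟨y', hy', hyF'⟩ := hJ.exists_supporting
  have hsum : ∀ {K : Finset E} {f : E →ₗ[ℝ] ℝ} {t : E → ℝ},
      f (∑ p ∈ K, t p • p) = ∑ p ∈ K, t p * f p := fun {K f t} => by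
    simp [map_sum]
  obtain ⟨t, ht, rfl⟩ := hzI
  obtain ⟨s, hs, hst⟩ := hzJ
  have htpos := coeff_pos_of_notMem_degenerateSet hI.subset hI.card_eq ht hzd
  have h1 : y (∑ p ∈ I, t p • p) ≤ y' (∑ p ∈ I, t p • p) := by
    rw [← hst, hsum, hsum]
    refine Finset.sum_le_sum fun p hp => mul_le_mul_of_nonneg_left ?_ (hs p hp)
    rw [hy' p hp]
    exact hyF p (hJ.subset hp)
  have h2 : ∀ p ∈ I, y' p = 1 := by
    have hle : ∀ p ∈ I, t p * y' p ≤ t p * y p := fun p hp => by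
      rw [hy p hp]
      exact mul_le_mul_of_nonneg_left (hyF' p (hI.subset hp)) (ht p hp)
    rw [hsum, hsum] at h1
    intro p hp
    have := (Finset.sum_eq_sum_iff_of_le hle).1 (le_antisymm (Finset.sum_le_sum hle) h1) p hp
    rw [mul_right_inj' (htpos p hp).ne', hy p hp] at this
    exact this
  have hli : LinearIndepOn ℝ id ((I ∪ J : Finset E) : Set E) := by
    refine (hF y').mono fun p hp => ?_
    rcases Finset.mem_union.1 hp with h | h
    exacts [⟨hI.subset h, h2 p h⟩, ⟨hJ.subset h, hy' p h⟩]
  have hcard : (I ∪ J).card ≤ Module.finrank ℝ E := by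
    simpa using hli.linearIndependent.fintype_card_le_finrank
  rw [Finset.eq_of_subset_of_card_le (Finset.subset_union_left (s₁ := I) (s₂ := J))
    (hcard.trans hI.card_eq.ge)]
  exact (Finset.eq_of_subset_of_card_le Finset.subset_union_right (hcard.trans hJ.card_eq.ge)).symm

end Triangulation

/-! ### Comparison of the volume deficits -/

section Deficit

variable {E : Type*} [NormedAddCommGroup E] [NormedSpace ℝ E]

theorem smul_mem_minkowskiSum {S : Set E} (hstar : StarConvex ℝ 0 S) {p : E} (hp : p ∈ S)
    {t : ℝ} (ht : 0 ≤ t) : t • p ∈ minkowskiSum S (⌊t⌋₊ + 1) := by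
  have hpos : (0 : ℝ) < (⌊t⌋₊ : ℝ) + 1 := by positivity
  have := nsmul_mem_minkowskiSum (starConvex_zero_iff.1 hstar hp (div_nonneg ht hpos.le)
    ((div_le_one hpos).2 (Nat.lt_floor_add_one t).le)) (⌊t⌋₊ + 1)
  rwa [← Nat.cast_smul_eq_nsmul ℝ, smul_smul, Nat.cast_add_one, mul_div_cancel₀ _ hpos.ne'] at this

/-- A combination of points of `S` that misses the `m`-fold Minkowski sum has coefficients with
large integer parts, since `t • p` is a sum of `⌊t⌋₊ + 1` points of the segment from `0` to `p`. -/
theorem lt_sum_floor_of_notMem_minkowskiSum {S : Set E} (hstar : StarConvex ℝ 0 S)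
    (h0 : (0 : E) ∈ S) {I : Finset E} (hI : (I : Set E) ⊆ S) {t : E → ℝ}
    (ht : ∀ p ∈ I, 0 ≤ t p) {m : ℕ} (h : ∑ p ∈ I, t p • p ∉ minkowskiSum S m) :
    m < ∑ p ∈ I, ⌊t p⌋₊ + I.card := by
  by_contra! hle
  refine h (minkowskiSum_subset_of_le h0 hle ?_)
  have := sum_mem_minkowskiSum I (fun p => t p • p) (fun p => ⌊t p⌋₊ + 1)
    fun p hp => smul_mem_minkowskiSum hstar (hI hp) (ht p hp)
  simpa [Finset.sum_add_distrib] using this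

variable [MeasurableSpace E] [BorelSpace E] [FiniteDimensional ℝ E]

theorem measure_degenerateSet (μ : Measure E) [μ.IsAddHaarMeasure] (F : Finset E) :
    μ (degenerateSet F) = 0 := by
  refine (measure_biUnion_null_iff (Finset.countable_toSet _)).2 fun J hJ => ?_
  refine Measure.addHaar_submodule μ _ fun htop => ?_
  have h1 := finrank_span_finset_le_card (R := ℝ) J
  have h2 := (Finset.mem_filter.1 hJ).2
  rw [Set.finrank, htop, finrank_top] at h1
  omega

theorem IsFacetBasis.measurableSet_finsetCone {F I : Finset E} (hI : IsFacetBasis F I) :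
    MeasurableSet (finsetCone I) := by
  obtain ⟨b, hb⟩ := exists_basis_of_card_eq hI.linearIndepOn hI.card_eq
  have hcone : finsetCone I = ⋂ i : I, {z | 0 ≤ b.repr z i} := by
    ext z
    simp only [mem_iInter, mem_ofPred_eq]
    constructor
    · rintro ⟨t, ht, rfl⟩ i
      rw [repr_sum_smul hb]
      exact ht i i.2
    · intro h
      obtain ⟨a, rfl⟩ := exists_sum_eq_of_basis b hb z
      refine ⟨a, fun p hp => ?_, rfl⟩
      have := h ⟨p, hp⟩
      rwa [repr_sum_smul hb] at this
  rw [hcone]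
  exact MeasurableSet.iInter fun i => measurableSet_le measurable_const (measurable_coord b i)

/-- The deficit inequality on the cone over one facet: subtracting a vertex of the facet from a
point of the deficit with index `k + 1` gives a point of the deficit with index `k`, provided that
the corresponding coefficient is at least `1`. -/
theorem IsFacetBasis.measure_deficit_le (μ : Measure E) [μ.IsAddHaarMeasure] {S : Set E}
    (hS : IsCompact S) (hstar : StarConvex ℝ 0 S) (h0 : (0 : E) ∈ S) {F I : Finset E}
    (hF : (F : Set E) ⊆ S) (hI : IsFacetBasis F I) {k : ℕ} (hk : 1 ≤ k)
    (hd : Module.finrank ℝ E ≤ k + 1) :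
    ((k + 2 - Module.finrank ℝ E : ℕ) : ℝ≥0∞) *
        μ ((((k : ℝ) + 1) • convexHull ℝ (insert 0 (F : Set E)) \ minkowskiSum S (k + 1)) ∩
          finsetCone I) ≤
      ((k + 1 : ℕ) : ℝ≥0∞) *
        μ (((k : ℝ) • convexHull ℝ (insert 0 (F : Set E)) \ minkowskiSum S k) ∩
          finsetCone I) := by
  classical
  obtain ⟨b, hb⟩ := exists_basis_of_card_eq hI.linearIndepOn hI.card_eq
  obtain ⟨y, hy, hyF⟩ := hI.exists_supporting
  have hIS : (I : Set E) ⊆ S := fun p hp => hF (hI.subset hp)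
  have hQ : IsCompact (convexHull ℝ (insert 0 (F : Set E))) :=
    (F.finite_toSet.insert 0).isCompact_convexHull ℝ
  have hmeas : ∀ (m : ℝ) (n : ℕ), MeasurableSet
      ((m • convexHull ℝ (insert 0 (F : Set E)) \ minkowskiSum S n) ∩ finsetCone I) := by
    intro m n
    exact ((hQ.smul m).measurableSet.diff (hS.minkowskiSum n).measurableSet).inter
      hI.measurableSet_finsetCone
  have hk0 : (0 : ℝ) < k := by exact_mod_cast hk
  have key := measure_le_of_sub_basis_mem μ b (hmeas k k) (hmeas (k + 1) (k + 1))
    (N := k + 2 - Module.finrank ℝ E) (by omega) ?_ ?_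
  · rwa [Fintype.card_coe, hI.card_eq,
      show k + 2 - Module.finrank ℝ E + Module.finrank ℝ E - 1 = k + 1 by omega] at key
  · rintro _ ⟨⟨hzQ, hzS⟩, t, ht, rfl⟩ i hi
    rw [repr_sum_smul hb] at hi
    rw [hb]
    have hsub : ∑ p ∈ I, (t p - if p = i then 1 else 0) • p = ∑ p ∈ I, t p • p - (i : E) := by
      simp [sub_smul, Finset.sum_sub_distrib, ite_smul]
    have hnonneg : ∀ p ∈ I, 0 ≤ t p - if p = i then 1 else 0 := by
      intro p hp
      split_ifs with h
      · rw [h]; linarith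
      · linarith [ht p hp]
    refine ⟨⟨?_, fun h => hzS ?_⟩, _, hnonneg, hsub⟩
    · have hyz : y (∑ p ∈ I, t p • p) ≤ k + 1 := by
        obtain ⟨s, hs, hsk, hsz⟩ := (mem_smul_convexHull_insert_zero_iff (by positivity)).1 hzQ
        rw [← hsz, map_sum]
        refine (Finset.sum_le_sum fun p hp => ?_).trans hsk
        rw [map_smul, smul_eq_mul]
        nlinarith [hs p hp, hyF p hp]
      have hyt : y (∑ p ∈ I, t p • p) = ∑ p ∈ I, t p := by
        rw [map_sum]
        exact Finset.sum_congr rfl fun p hp => by rw [map_smul, hy p hp, smul_eq_mul, mul_one]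
      refine smul_set_mono (convexHull_mono (insert_subset_insert
        (Finset.coe_subset.2 hI.subset))) ?_
      refine (mem_smul_convexHull_insert_zero_iff hk0).2 ⟨_, hnonneg, ?_, hsub⟩
      rw [Finset.sum_sub_distrib, ← hyt]
      simp only [Finset.sum_ite_eq', i.2, if_true]
      linarith
    · rw [minkowskiSum_succ]
      exact ⟨_, h, i, hIS i.2, sub_add_cancel _ _⟩
  · rintro _ ⟨⟨-, hzS⟩, t, ht, rfl⟩
    have := lt_sum_floor_of_notMem_minkowskiSum hstar h0 hIS ht hzS
    simp only [repr_sum_smul hb]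
    rw [Finset.sum_coe_sort I fun p => ⌊t p⌋₊]
    rw [hI.card_eq] at this
    omega

/-- Comparison of the volume deficits of two consecutive Minkowski sums relative to the dilates of
a polytope with vertices in general position, by summation over its facets. -/
theorem measure_deficit_convexHull_le (μ : Measure E) [μ.IsAddHaarMeasure] {S : Set E}
    (hS : IsCompact S) (hstar : StarConvex ℝ 0 S) (h0 : (0 : E) ∈ S) {F : Finset E}
    (hF : (F : Set E) ⊆ S) (hgen : GeneralPosition F) {k : ℕ} (hk : 1 ≤ k)
    (hd : Module.finrank ℝ E ≤ k + 1) :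
    ((k + 2 - Module.finrank ℝ E : ℕ) : ℝ≥0∞) *
        μ (((k : ℝ) + 1) • convexHull ℝ (insert 0 (F : Set E)) \ minkowskiSum S (k + 1)) ≤
      ((k + 1 : ℕ) : ℝ≥0∞) *
        μ ((k : ℝ) • convexHull ℝ (insert 0 (F : Set E)) \ minkowskiSum S k) := by
  classical
  set D' := ((k : ℝ) + 1) • convexHull ℝ (insert 0 (F : Set E)) \ minkowskiSum S (k + 1)
  set D := (k : ℝ) • convexHull ℝ (insert 0 (F : Set E)) \ minkowskiSum S k with hD
  let B := F.powerset.filter (IsFacetBasis F)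
  have hB : ∀ I ∈ B, IsFacetBasis F I := fun I hI => (Finset.mem_filter.1 hI).2
  have hcover : D' ⊆ degenerateSet F ∪ ⋃ I ∈ B, D' ∩ finsetCone I := by
    intro z hz
    by_cases hzd : z ∈ degenerateSet F
    · exact Or.inl hzd
    obtain ⟨t, ht, -, htz⟩ := (mem_smul_convexHull_insert_zero_iff (by positivity)).1 hz.1
    obtain ⟨I, hI, hzI⟩ := exists_isFacetBasis_of_notMem_degenerateSet ⟨t, ht, htz⟩ hzd
    exact Or.inr (mem_biUnion (Finset.mem_coe.2 (Finset.mem_filter.2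
      ⟨Finset.mem_powerset.2 hI.subset, hI⟩)) ⟨hz, hzI⟩)
  have hle : μ D' ≤ ∑ I ∈ B, μ (D' ∩ finsetCone I) :=
    calc μ D' ≤ μ (degenerateSet F) + μ (⋃ I ∈ B, D' ∩ finsetCone I) :=
          (measure_mono hcover).trans (measure_union_le _ _)
      _ ≤ _ := by
          rw [measure_degenerateSet, zero_add]
          exact measure_biUnion_finset_le _ _
  have hDm : MeasurableSet D :=
    (((F.finite_toSet.insert 0).isCompact_convexHull ℝ).smul _).measurableSet.diff
      (hS.minkowskiSum k).measurableSet
  have hdisj : ∑ I ∈ B, μ (D ∩ finsetCone I) ≤ μ D := by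
    rw [← measure_biUnion_finset₀]
    · exact measure_mono (iUnion₂_subset fun I _ => inter_subset_left)
    · intro I hI J hJ hIJ
      refine measure_mono_null ?_ (measure_degenerateSet μ F)
      rintro z ⟨hzI, hzJ⟩
      by_contra hzd
      exact hIJ ((hB I hI).eq_of_mem_finsetCone hgen (hB J hJ) hzI.2 hzJ.2 hzd)
    · exact fun I hI => (hDm.inter (hB I hI).measurableSet_finsetCone).nullMeasurableSet
  calc _ ≤ ((k + 2 - Module.finrank ℝ E : ℕ) : ℝ≥0∞) * ∑ I ∈ B, μ (D' ∩ finsetCone I) := by gcongr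
    _ ≤ ((k + 1 : ℕ) : ℝ≥0∞) * ∑ I ∈ B, μ (D ∩ finsetCone I) := by
        rw [Finset.mul_sum, Finset.mul_sum]
        exact Finset.sum_le_sum fun I hI =>
          (hB I hI).measure_deficit_le μ hS hstar h0 hF hk hd
    _ ≤ _ := by gcongr

end Deficit

/-! ### The numerical inequality -/

theorem two_mul_pow_mul_sq_ge (x : ℝ) (hx : 0 ≤ x) (n : ℕ) :
    x ^ n * (2 * x ^ 2 + 2 * n * x + n * (n - 1)) ≤ 2 * (x + 1) ^ n * x ^ 2 := by
  induction n with
  | zero => simp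
  | succ n ih =>
    have hn : (0 : ℝ) ≤ n * (n - 1) := by
      rcases n with _ | n
      · simp
      · push_cast
        have : (0 : ℝ) ≤ n := n.cast_nonneg
        nlinarith
    have h1 := mul_le_mul_of_nonneg_right ih (by linarith : 0 ≤ x + 1)
    have h2 : 0 ≤ x ^ n * (n * (n - 1)) := mul_nonneg (by positivity) hn
    push_cast
    rw [pow_succ x n, pow_succ (x + 1) n]
    linarith

/-- The numerical inequality `(k + 1) / (k + 2 - d) ≤ ((k + 1) / k) ^ d`, with denominators
cleared. It follows from the first three terms of the binomial expansion of the right-hand side. -/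
theorem pow_le_sub_mul_pow {d k : ℕ} (hd : 2 ≤ d) (hk : (d - 1) * (d - 2) ≤ k) (hk1 : 1 ≤ k) :
    k ^ d ≤ (k + 2 - d) * (k + 1) ^ (d - 1) := by
  obtain ⟨e, rfl⟩ := Nat.exists_eq_add_of_le' hd
  rw [show e + 2 - 1 = e + 1 by omega, show e + 2 - 2 = e by omega] at hk
  rw [show e + 2 - 1 = e + 1 by omega, show k + 2 - (e + 2) = k - e by omega]
  have hek : e ≤ k := by nlinarith
  suffices h : (k : ℝ) ^ (e + 2) ≤ ((k - e : ℕ) : ℝ) * ((k : ℝ) + 1) ^ (e + 1) by exact_mod_cast h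
  rw [Nat.cast_sub hek]
  have hk' : ((e : ℝ) + 1) * e ≤ k := by exact_mod_cast hk
  have hek' : (e : ℝ) ≤ k := by exact_mod_cast hek
  have hk0 : (0 : ℝ) < k := by exact_mod_cast hk1
  have he0 : (0 : ℝ) ≤ e := e.cast_nonneg
  have h1 := mul_le_mul_of_nonneg_left (two_mul_pow_mul_sq_ge (k : ℝ) hk0.le (e + 1))
    (sub_nonneg.2 hek')
  have h2 : 2 * (k : ℝ) ^ 3 ≤
      (k - e) * (2 * (k : ℝ) ^ 2 + 2 * (e + 1 : ℕ) * k + (e + 1 : ℕ) * ((e + 1 : ℕ) - 1)) := by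
    push_cast
    have h3 : ((e : ℝ) + 1) * e * (k + e) ≤ k * (2 * k) :=
      mul_le_mul hk' (by linarith) (by positivity) hk0.le
    nlinarith
  have h4 := mul_le_mul_of_nonneg_left h2 (by positivity : (0 : ℝ) ≤ (k : ℝ) ^ (e + 1))
  have h5 : 2 * (k : ℝ) ^ 2 * (k : ℝ) ^ (e + 2) ≤
      2 * (k : ℝ) ^ 2 * (((k : ℝ) - e) * ((k : ℝ) + 1) ^ (e + 1)) := by
    calc _ = (k : ℝ) ^ (e + 1) * (2 * (k : ℝ) ^ 3) := by ring
      _ ≤ _ := h4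
      _ = _ := by ring
      _ ≤ _ := h1
      _ = _ := by ring
  exact le_of_mul_le_mul_left h5 (by positivity)

/-! ### Passage to the convex hull of a star-shaped set -/

section Monotonicity

variable {E : Type*} [NormedAddCommGroup E] [NormedSpace ℝ E] [MeasurableSpace E] [BorelSpace E]
  [FiniteDimensional ℝ E]

/-- The volume of the convex hull of a star-shaped set is approximated from below by convex hulls
of the origin and finitely many points of the set in general position. -/
theorem exists_generalPosition_lt_measure (μ : Measure E) [μ.IsAddHaarMeasure] {S : Set E}
    (hstar : StarConvex ℝ 0 S) (h0 : (0 : E) ∈ S) {a : ℝ≥0∞} (ha : a < μ (convexHull ℝ S)) :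
    ∃ F : Finset E, (F : Set E) ⊆ S ∧ GeneralPosition F ∧
      a < μ (convexHull ℝ (insert 0 (F : Set E))) := by
  classical
  have : Nonempty S := ⟨⟨0, h0⟩⟩
  let T : ℕ → Finset E := fun n =>
    (Finset.range n).image fun i => (TopologicalSpace.denseSeq S i : E)
  have hTS : ∀ n, (T n : Set E) ⊆ S := by
    intro n p hp
    obtain ⟨i, -, rfl⟩ := Finset.mem_image.1 (Finset.mem_coe.1 hp)
    exact Subtype.coe_prop _
  let H : ℕ → Set E := fun n => convexHull ℝ (insert 0 (T n : Set E))
  have hH : Monotone H := fun m n hmn => convexHull_mono (insert_subset_insert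
    (Finset.coe_subset.2 (Finset.image_subset_image (Finset.range_mono hmn))))
  have hU : Convex ℝ (⋃ n, H n) :=
    hH.directed_le.convex_iUnion fun n => convex_convexHull ℝ _
  have hsub : convexHull ℝ S ⊆ closure (⋃ n, H n) := by
    refine convexHull_min (fun x hx => ?_) hU.closure
    have hd := TopologicalSpace.denseRange_denseSeq S
    have hx' : x ∈ Subtype.val '' closure (range (TopologicalSpace.denseSeq S)) :=
      ⟨⟨x, hx⟩, hd _, rfl⟩
    refine closure_mono ?_ (image_closure_subset_closure_image continuous_subtype_val hx')
    rintro _ ⟨_, ⟨i, rfl⟩, rfl⟩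
    refine mem_iUnion.2 ⟨i + 1, subset_convexHull ℝ _ (mem_insert_of_mem _ ?_)⟩
    exact Finset.mem_coe.2 (Finset.mem_image.2 ⟨i, by simp, rfl⟩)
  have hle : μ (convexHull ℝ S) ≤ ⨆ n, μ (H n) := by
    rw [← hH.measure_iUnion]
    refine (measure_mono (hsub.trans (closure_eq_self_union_frontier _).subset)).trans
      ((measure_union_le _ _).trans ?_)
    rw [hU.addHaar_frontier μ, add_zero]
  obtain ⟨n, hn⟩ := lt_iSup_iff.1 (ha.trans_le hle)
  obtain ⟨ρ, hρ, hρ0, hρ1⟩ : ∃ ρ : ℝ, a < ENNReal.ofReal (ρ ^ Module.finrank ℝ E) * μ (H n) ∧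
      0 < ρ ∧ ρ < 1 := by
    have hfin : μ (H n) ≠ ∞ :=
      (((T n).finite_toSet.insert 0).isCompact_convexHull ℝ).measure_lt_top.ne
    have h1 : Tendsto (fun ρ : ℝ => ENNReal.ofReal (ρ ^ Module.finrank ℝ E) * μ (H n))
        (𝓝[<] 1) (𝓝 (ENNReal.ofReal (1 ^ Module.finrank ℝ E) * μ (H n))) :=
      ENNReal.Tendsto.mul_const (ENNReal.tendsto_ofReal
        (((continuous_pow _).tendsto 1).mono_left nhdsWithin_le_nhds)) (Or.inr hfin)
    rw [one_pow, ENNReal.ofReal_one, one_mul] at h1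
    have h2 : ∀ᶠ ρ : ℝ in 𝓝[<] 1, 0 < ρ :=
      nhdsWithin_le_nhds (lt_mem_nhds zero_lt_one)
    exact ((h1.eventually_const_lt hn).and (h2.and self_mem_nhdsWithin)).exists
  obtain ⟨G, hG, hGT, hTG⟩ := exists_generalPosition (T n) hρ0.le hρ1
  refine ⟨G, fun q hq => ?_, hG, hρ.trans_le ?_⟩
  · obtain ⟨p, hp, c, hc, rfl⟩ := hGT q hq
    exact starConvex_zero_iff.1 hstar (hTS n hp) hc.1 hc.2
  · rw [← Measure.addHaar_smul_of_nonneg μ hρ0.le, ← convexHull_smul]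
    have hconv := convex_convexHull ℝ (insert 0 (G : Set E))
    have h0G : (0 : E) ∈ convexHull ℝ (insert 0 (G : Set E)) :=
      subset_convexHull ℝ _ (mem_insert _ _)
    refine measure_mono (convexHull_min ?_ hconv)
    rintro _ ⟨p, rfl | hp, rfl⟩
    · simpa using h0G
    · obtain ⟨c, hc, hcG⟩ := hTG p hp
      have hc0 : 0 < c := hρ0.trans_le hc.1
      have := hconv.smul_mem_of_zero_mem h0G
        (subset_convexHull ℝ _ (mem_insert_of_mem _ (Finset.mem_coe.2 hcG)))
        (t := ρ / c) ⟨by positivity, (div_le_one hc0).2 hc.1⟩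
      rwa [smul_smul, div_mul_cancel₀ _ hc0.ne'] at this

theorem minkowskiSum_subset_smul_convexHull {E : Type*} [AddCommGroup E] [Module ℝ E] {S : Set E}
    (hS : S.Nonempty) (k : ℕ) : minkowskiSum S k ⊆ (k : ℝ) • convexHull ℝ S := by
  induction k with
  | zero =>
    rw [minkowskiSum_zero, Nat.cast_zero, zero_smul_set (hS.mono (subset_convexHull ℝ S))]
    exact subset_rfl
  | succ k ih =>
    rw [minkowskiSum_succ, Nat.cast_add_one,
      (convex_convexHull ℝ S).add_smul k.cast_nonneg zero_le_one, one_smul]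
    exact add_subset_add ih (subset_convexHull ℝ S)

/-- Monotonicity of the normalized volume of the Minkowski sums of a compact set that is
star-shaped about the origin. -/
theorem StarConvex.measureReal_minkowskiSum_le (μ : Measure E) [μ.IsAddHaarMeasure] {S : Set E}
    (hS : IsCompact S) (hstar : StarConvex ℝ 0 S) (h0 : (0 : E) ∈ S) {d k : ℕ}
    (hdim : Module.finrank ℝ E = d) (hd : 2 ≤ d) (hk1 : 1 ≤ k) (hk : (d - 1) * (d - 2) ≤ k) :
    ((k : ℝ) + 1) ^ d * μ.real (minkowskiSum S k) ≤
      (k : ℝ) ^ d * μ.real (minkowskiSum S (k + 1)) := by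
  have hk0 : (0 : ℝ) < k := by exact_mod_cast hk1
  have hdk : d ≤ k + 1 := by
    obtain ⟨e, rfl⟩ := Nat.exists_eq_add_of_le' hd
    rw [show e + 2 - 1 = e + 1 by omega, show e + 2 - 2 = e by omega] at hk
    rcases e with _ | e
    · omega
    · nlinarith
  have hKfin : μ (convexHull ℝ S) ≠ ∞ :=
    (isBounded_convexHull.2 hS.isBounded).measure_lt_top.ne
  have hkK : μ ((k : ℝ) • convexHull ℝ S) ≠ ∞ := by
    rw [Measure.addHaar_smul]
    exact ENNReal.mul_ne_top ENNReal.ofReal_ne_top hKfin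
  have hsmul : ∀ (r : ℝ) (X : Set E), 0 ≤ r → μ.real (r • X) = r ^ d * μ.real X := by
    intro r X hr
    rw [measureReal_def, Measure.addHaar_smul_of_nonneg μ hr, ENNReal.toReal_mul,
      ENNReal.toReal_ofReal (by positivity), hdim, measureReal_def]
  have hsubK := minkowskiSum_subset_smul_convexHull ⟨0, h0⟩ k
  set s := μ.real (minkowskiSum S k) with hs
  set s' := μ.real (minkowskiSum S (k + 1)) with hs'
  set κ := μ.real (convexHull ℝ S) with hκ
  have hsκ : s ≤ (k : ℝ) ^ d * κ := by
    rw [hκ, ← hsmul _ _ hk0.le]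
    exact measureReal_mono hsubK hkK
  by_contra! hlt
  have hκ0 : 0 < κ := by
    by_contra! h
    have h1 : s ≤ 0 := hsκ.trans (mul_nonpos_of_nonneg_of_nonpos (by positivity) h)
    have h2 : 0 ≤ (k : ℝ) ^ d * s' := mul_nonneg (by positivity) measureReal_nonneg
    have h3 : ((k : ℝ) + 1) ^ d * s ≤ 0 := mul_nonpos_of_nonneg_of_nonpos (by positivity) h1
    linarith
  -- A polytope whose volume differs from that of the convex hull by less than the assumed gap.
  set δ := (((k : ℝ) + 1) ^ d * s - (k : ℝ) ^ d * s') / ((k : ℝ) ^ d * ((k : ℝ) + 1) ^ d) with hδ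
  have hδ0 : 0 < δ := div_pos (by linarith) (by positivity)
  obtain ⟨F, hFS, hF, hq⟩ := exists_generalPosition_lt_measure μ hstar h0
    (a := ENNReal.ofReal (κ - δ)) (by
      rw [← ENNReal.ofReal_toReal hKfin]
      exact (ENNReal.ofReal_lt_ofReal_iff hκ0).2 (by rw [hκ, measureReal_def]; linarith))
  set Q := convexHull ℝ (insert 0 (F : Set E)) with hQ
  have hQc : IsCompact Q := (F.finite_toSet.insert 0).isCompact_convexHull ℝ
  have hQK : Q ⊆ convexHull ℝ S := convexHull_mono (insert_subset h0 hFS)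
  have hq' : κ - δ < μ.real Q := by
    by_contra! h
    refine hq.not_ge ?_
    rw [← ENNReal.ofReal_toReal hQc.measure_lt_top.ne]
    exact ENNReal.ofReal_le_ofReal h
  have hSc := hS.minkowskiSum (k + 1)
  set D := (k : ℝ) • Q \ minkowskiSum S k with hD
  set D' := ((k : ℝ) + 1) • Q \ minkowskiSum S (k + 1) with hD'
  have hDfin : μ D ≠ ∞ := measure_ne_top_of_subset sdiff_subset (hQc.smul _).measure_lt_top.ne
  have hdef : ((k + 2 - d : ℕ) : ℝ) * μ.real D' ≤ ((k : ℝ) + 1) * μ.real D := by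
    have := measure_deficit_convexHull_le μ hS hstar h0 hFS hF hk1 (hdim ▸ hdk)
    rw [hdim] at this
    have := ENNReal.toReal_mono (ENNReal.mul_ne_top (ENNReal.natCast_ne_top _) hDfin) this
    rwa [ENNReal.toReal_mul, ENNReal.toReal_mul, ENNReal.toReal_natCast, ENNReal.toReal_natCast,
      Nat.cast_add_one] at this
  have hDle : μ.real D ≤ (k : ℝ) ^ d * κ - s := by
    rw [hκ, ← hsmul _ _ hk0.le, hs, ← measureReal_sdiff hsubK
      (hS.minkowskiSum k).measurableSet hkK]
    exact measureReal_mono (sdiff_subset_sdiff_left (smul_set_mono hQK))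
      (measure_ne_top_of_subset sdiff_subset hkK)
  have hDge : ((k : ℝ) + 1) ^ d * μ.real Q ≤ μ.real D' + s' := by
    rw [← hsmul _ _ (by positivity)]
    refine (measureReal_mono (s₂ := D' ∪ minkowskiSum S (k + 1)) ?_ ?_).trans
      (measureReal_union_le _ _)
    · rw [hD', sdiff_union_self]
      exact subset_union_left
    · rw [hD', sdiff_union_self]
      exact ((hQc.smul _).union hSc).measure_lt_top.ne
  have hnum : (k : ℝ) ^ d ≤ ((k + 2 - d : ℕ) : ℝ) * ((k : ℝ) + 1) ^ (d - 1) := by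
    exact_mod_cast pow_le_sub_mul_pow hd hk hk1
  have hpow : ((k : ℝ) + 1) ^ d = ((k : ℝ) + 1) ^ (d - 1) * ((k : ℝ) + 1) := by
    rw [← pow_succ, Nat.sub_add_cancel (by omega)]
  have hcmp : (k : ℝ) ^ d * μ.real D' ≤ ((k : ℝ) + 1) ^ d * μ.real D :=
    calc (k : ℝ) ^ d * μ.real D'
        ≤ ((k + 2 - d : ℕ) : ℝ) * ((k : ℝ) + 1) ^ (d - 1) * μ.real D' := by gcongr
      _ = ((k : ℝ) + 1) ^ (d - 1) * (((k + 2 - d : ℕ) : ℝ) * μ.real D') := by ring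
      _ ≤ ((k : ℝ) + 1) ^ (d - 1) * (((k : ℝ) + 1) * μ.real D) := by gcongr
      _ = _ := by rw [hpow]; ring
  have hA : (0 : ℝ) < (k : ℝ) ^ d := by positivity
  have hB : (0 : ℝ) < ((k : ℝ) + 1) ^ d := by positivity
  have e1 : ((k : ℝ) ^ d * ((k : ℝ) + 1) ^ d) * δ =
      ((k : ℝ) + 1) ^ d * s - (k : ℝ) ^ d * s' := mul_div_cancel₀ _ (by positivity)
  have e2 := mul_le_mul_of_nonneg_left hDle hB.le
  have e3 := mul_le_mul_of_nonneg_left hDge hA.le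
  have e4 := mul_lt_mul_of_pos_left hq' (mul_pos hA hB)
  linarith

end Monotonicity

/-! ### Reduction to star-shaped sets centred at the origin -/

/-- A translation reduces to the case of a set that is star-shaped about the origin. -/
theorem IsStarShaped.exists_vadd {E : Type*} [AddCommGroup E] [Module ℝ E] {S : Set E}
    (hS : IsStarShaped S) : ∃ v : E, StarConvex ℝ 0 (v +ᵥ S) ∧ (0 : E) ∈ v +ᵥ S := by
  obtain ⟨⟨x, hx⟩, p, hp⟩ := hS
  have hpS : p ∈ S := hp x hx (left_mem_segment ℝ p x)
  have hstar : StarConvex ℝ p S := starConvex_iff_segment_subset.2 fun q hq => hp q hq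
  refine ⟨-p, ?_, ⟨p, hpS, by simp⟩⟩
  have := hstar.add_left (-p)
  rwa [neg_add_cancel] at this

theorem mainTheorem5 (d k : ℕ) (hd : 2 ≤ d) (hk : max 2 ((d - 1) * (d - 2)) ≤ k)
    (A S : Set (EuclideanSpace ℝ (Fin d))) (hA : IsCompact A) (hS : IsCompact S)
    (hSstar : IsStarShaped S) (hSA : frontier S ⊆ A) (hAS : A ⊆ S) :
    volume ((1 / (k : ℝ)) • minkowskiSum A k) ≤
      volume ((1 / ((k : ℝ) + 1)) • minkowskiSum A (k + 1)) := by
  obtain ⟨hk2, hkd⟩ := max_le_iff.1 hk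
  obtain ⟨v, hstar, h0⟩ := hSstar.exists_vadd
  have hdim : Module.finrank ℝ (EuclideanSpace ℝ (Fin d)) = d := by simp
  have hrank : 1 < Module.rank ℝ (EuclideanSpace ℝ (Fin d)) := by
    rw [← Module.finrank_eq_rank, hdim]
    exact_mod_cast hd
  have hSc : IsCompact (v +ᵥ S) := hS.vadd v
  have hfr : frontier (v +ᵥ S) ⊆ v +ᵥ A := by
    have h : frontier (v +ᵥ S) = v +ᵥ frontier S :=
      ((Homeomorph.addLeft v).image_frontier S).symm
    rw [h]
    exact vadd_set_mono hSA
  have hsum : (v +ᵥ S) + (v +ᵥ S) ⊆ (v +ᵥ A) + (v +ᵥ A) :=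
    (hstar.add_subset_frontier_add_frontier hSc h0 hrank).trans (add_subset_add hfr hfr)
  have hAeq : ∀ n, 2 ≤ n → volume.real (minkowskiSum (v +ᵥ S) n) =
      volume.real (minkowskiSum A n) := by
    intro n hn
    have h : minkowskiSum (v +ᵥ S) n = minkowskiSum (v +ᵥ A) n :=
      (minkowskiSum_subset_of_add_subset (vadd_set_mono hAS) hsum hn).antisymm
        (minkowskiSum_mono (vadd_set_mono hAS) n)
    rw [h, minkowskiSum_vadd, measureReal_def, measure_vadd, measureReal_def]
  have key := hstar.measureReal_minkowskiSum_le volume hSc h0 hdim hd (by omega) hkd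
  rw [hAeq k hk2, hAeq (k + 1) (by omega)] at key
  have hk0 : (0 : ℝ) < k := by exact_mod_cast (show 0 < k by omega)
  have hfin : ∀ n, volume (minkowskiSum A n) = ENNReal.ofReal (volume.real (minkowskiSum A n)) :=
    fun n => (ENNReal.ofReal_toReal (hA.minkowskiSum n).measure_lt_top.ne).symm
  rw [Measure.addHaar_smul_of_nonneg _ (by positivity),
    Measure.addHaar_smul_of_nonneg _ (by positivity), hdim, hfin, hfin,
    ← ENNReal.ofReal_mul (by positivity), ← ENNReal.ofReal_mul (by positivity)]
  refine ENNReal.ofReal_le_ofReal ?_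
  rw [div_pow, div_pow, one_pow, one_div_mul_eq_div, one_div_mul_eq_div,
    div_le_div_iff₀ (by positivity) (by positivity)]
  linarith
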